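/- Fix $n$, $0\le\gamma<1$ and put $\alpha=\frac{4}{3+\gamma}$, $\Delta_\infty u=\sum_{i,j}D_{ij}u\,D_iu\,D_ju$. All equations below are understood in the viscosity sense ($C^2$ test functions). **Setting.** Let $\Omega\subset\mathbb R^n$ be a bounded open set, $\delta>0$, and let $\mathcal B:\mathbb R\to\mathbb R$ be Lipschitz with $0\le\mathcal B\le1$ on $[0,\infty)$, $\mathcal B=0$ on $(-\infty,\delta/2]$ and $\mathcal B=1$ on $[\delta,\infty)$. For $\varepsilon>0$ put $\mathcal B_\varepsilon(s)=\mathcal B(s/\varepsilon^\alpha)$ and consider, for boundary data $\varphi_\varepsilon\ge0$, the penalized problem $$(P_\varepsilon)\qquad \Delta_\infty v=\mathcal B_\varepsilon(v)\,v^{-\gamma}\ \text{ in }\Omega,\qquad v=\varphi_\varepsilon\ \text{ on }\partial\Omega,$$ where the right-hand side is read as $0$ wherever $v\le\frac{\delta}{2}\varepsilon^\alpha$. A *minimal solution* of $(P_\varepsilon)$ is a viscosity solution $u_\varepsilon\in C(\overline\Omega)$ that is the least element of the class of all viscosity supersolutions $w\in C(\overline\Omega)$ of the equation with $\underline u\le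 w\le\overline u$ on $\overline\Omega$; here $\underline u,\overline u\in C(\overline\Omega)$ satisfy $\underline u=\overline u=\varphi_\varepsilon$ on $\partial\Omega$, $\Delta_\infty\overline u=0$ in $\Omega$ and $\Delta_\infty\underline u=K$ in $\Omega$, with $K$ a constant such that $\mathcal B_\varepsilon(s)s^{-\gamma}\le K$ for all $s$. Let $u:\Omega\to\mathbb R$ be a locally uniform limit in $\Omega$ of minimal solutions $u_{\varepsilon_k}$ of $(P_{\varepsilon_k})$ along a sequence $\varepsilon_k\to0^+$. Write $\{u>0\}=\{x\in\Omega: u(x)>0\}$. **Theorem.** Given $n$, $0\le\gamma<1$, $M$ and $d>0$, there are positive constants $C$, $c$ and $r_0\le d$, depending only on $n,\gamma,M,d$, such that for all $\Omega,\delta,\mathcal B,u$ as above with $\|u\|_{L^\infty(\Omega)}\le M$ and all $\Omega'\subset\Omega$ with $\operatorname{dist}(\Omega',\partial\Omega)\ge d$ the following hold. 1. $\Delta_\infty u=u^{-\gamma}$ in $\{u>0\}$ in the viscosity sense. 2. For every $x\in\partial\{u>0\}\cap\Omega'$ and every $0<r\le r_0$, $$c\,r^\alpha\le\sup_{B_r(x)}u\le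 C\,r^\alpha .$$ 3. At every $x\in\partial\{u>0\}\cap\Omega$ the function $u$ is differentiable and $Du(x)=0$. 4. $u$ is locally $C^{1,\frac{1-\gamma}{3+\gamma}}$ along $\partial\{u>0\}$: for every $x\in\partial\{u>0\}\cap\Omega'$ and every $y\in B_{r_0}(x)$, $$|u(y)-u(x)-Du(x)\cdot(y-x)|\le C\,|y-x|^{1+\frac{1-\gamma}{3+\gamma}} .$$ -/

import Mathlib

open Filter Topology

namespace SingularInfinity

/-- Euclidean space `ℝⁿ`. -/
abbrev Rn (n : ℕ) : Type := EuclideanSpace ℝ (Fin n)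

/-- The exponent `α = 4 / (3 + γ)`. -/
noncomputable def alpha (γ : ℝ) : ℝ := 4 / (3 + γ)

/-- The infinity Laplacian `Δ_∞ψ = ∑ᵢⱼ Dᵢⱼψ Dᵢψ Dⱼψ = ⟨D²ψ Dψ, Dψ⟩` of a twice differentiable
function. -/
noncomputable def infLaplacian {n : ℕ} (ψ : Rn n → ℝ) (x : Rn n) : ℝ :=
  fderiv ℝ (fderiv ℝ ψ) x (gradient ψ x) (gradient ψ x)

/-- `Δ_∞ u ≥ G(u)` in `U` in the viscosity sense: the inequality holds for every function that is
`C²` near a point of `U` and touches `u` from above there (up to an additive constant). -/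
def IsViscositySub {n : ℕ} (G : ℝ → ℝ) (U : Set (Rn n)) (u : Rn n → ℝ) : Prop :=
  ∀ x ∈ U, ∀ ψ : Rn n → ℝ, ContDiffAt ℝ 2 ψ x →
    IsLocalMax (fun y => u y - ψ y) x → G (u x) ≤ infLaplacian ψ x

/-- `Δ_∞ u ≤ G(u)` in `U` in the viscosity sense: the inequality holds for every function that is
`C²` near a point of `U` and touches `u` from below there (up to an additive constant). -/
def IsViscositySuper {n : ℕ} (G : ℝ → ℝ) (U : Set (Rn n)) (u : Rn n → ℝ) : Prop :=
  ∀ x ∈ U, ∀ ψ : Rn n → ℝ, ContDiffAt ℝ 2 ψ x →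
    IsLocalMin (fun y => u y - ψ y) x → infLaplacian ψ x ≤ G (u x)

/-- `u` is a (continuous) viscosity solution of `Δ_∞ u = G(u)` in the open set `U`. -/
structure IsViscositySol {n : ℕ} (G : ℝ → ℝ) (U : Set (Rn n)) (u : Rn n → ℝ) : Prop where
  cont : ContinuousOn u U
  sub : IsViscositySub G U u
  super : IsViscositySuper G U u

/-- The cut-off `𝓑`: a Lipschitz function with `0 ≤ 𝓑 ≤ 1` on `[0, ∞)`, `𝓑 = 0` on `(-∞, δ/2]`
and `𝓑 = 1` on `[δ, ∞)`. -/
structure IsCutoff (δ : ℝ) (B : ℝ → ℝ) : Prop where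
  lipschitz : ∃ K : NNReal, LipschitzWith K B
  nonneg : ∀ s, 0 ≤ s → 0 ≤ B s
  le_one : ∀ s, 0 ≤ s → B s ≤ 1
  eq_zero : ∀ s, s ≤ δ / 2 → B s = 0
  eq_one : ∀ s, δ ≤ s → B s = 1

/-- The penalized source `s ↦ 𝓑_ε(s) s^{-γ}`, where `𝓑_ε(s) = 𝓑(s / ε^α)`. For a cut-off `𝓑`
the first factor vanishes for `s ≤ (δ/2) ε^α`, hence so does the product. -/
noncomputable def source (γ : ℝ) (B : ℝ → ℝ) (ε : ℝ) (s : ℝ) : ℝ :=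
  B (s / ε ^ alpha γ) * s ^ (-γ)

/-- The Perron class: supersolutions `w ∈ C(Ω̄)` of `Δ_∞ w = G(w)` in `Ω` with
`lo ≤ w ≤ hi` on `Ω̄`. -/
def perronClass {n : ℕ} (G : ℝ → ℝ) (Ω : Set (Rn n)) (lo hi : Rn n → ℝ) : Set (Rn n → ℝ) :=
  {w | ContinuousOn w (closure Ω) ∧ IsViscositySuper G Ω w ∧
    ∀ x ∈ closure Ω, lo x ≤ w x ∧ w x ≤ hi x}

/-- `v ∈ C(Ω̄)` is the minimal (Perron) viscosity solution of `Δ_∞ v = 𝓑_ε(v) v^{-γ}` in `Ω`,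
`v = φ` on `∂Ω`: it is a viscosity solution, and it is the least element of the class of
supersolutions lying between `lo` and `hi`. Here `lo` solves `Δ_∞ lo = K` for a constant `K`
bounding the source term from above, `hi` is infinity harmonic, and `lo = hi = φ` on `∂Ω`. -/
def IsMinimalSol {n : ℕ} (γ : ℝ) (B : ℝ → ℝ) (ε : ℝ) (Ω : Set (Rn n)) (φ v : Rn n → ℝ) : Prop :=
  IsViscositySol (source γ B ε) Ω v ∧
  ∃ (K : ℝ) (lo hi : Rn n → ℝ),
    (∀ s, source γ B ε s ≤ K) ∧
    ContinuousOn lo (closure Ω) ∧ IsViscositySol (fun _ => K) Ω lo ∧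
    ContinuousOn hi (closure Ω) ∧ IsViscositySol (fun _ => 0) Ω hi ∧
    (∀ x ∈ frontier Ω, lo x = φ x ∧ hi x = φ x) ∧
    v ∈ perronClass (source γ B ε) Ω lo hi ∧
    ∀ w ∈ perronClass (source γ B ε) Ω lo hi, ∀ x ∈ closure Ω, v x ≤ w x

/-- `u` is a limit, locally uniform in `Ω`, of minimal solutions `u_ε` of the penalized problems
with nonnegative boundary data `φ_ε`, along some sequence `ε = ε_k → 0⁺`. -/
def IsLimitOfMinimalSols {n : ℕ} (γ : ℝ) (B : ℝ → ℝ) (Ω : Set (Rn n)) (u : Rn n → ℝ) : Prop :=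
  ∃ (ε : ℕ → ℝ) (φ v : ℕ → Rn n → ℝ),
    (∀ k, 0 < ε k) ∧ Tendsto ε atTop (𝓝 0) ∧
    (∀ k, ∀ x ∈ frontier Ω, 0 ≤ φ k x) ∧
    (∀ k, IsMinimalSol γ B (ε k) Ω (φ k) (v k)) ∧
    TendstoLocallyUniformlyOn v u atTop Ω

/-- The positivity set `{u > 0}`, a subset of `Ω`. -/
def posSet {n : ℕ} (Ω : Set (Rn n)) (u : Rn n → ℝ) : Set (Rn n) := {x | x ∈ Ω ∧ 0 < u x}

end SingularInfinity

/-! The exponent `alpha γ` makes powers of cones scale like the equation: `(a - Λ|z - p|)^α`, with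
value `b^α` at `z`, has infinity Laplacian `α³(α-1)Λ⁴ b^(3α-4)`, and `3α - 4 = -αγ` turns this into
a multiple of `(b^α)^(-γ)`.

Growth. Penalized solutions are nonnegative, and the source is at most `2(s + η)^(-γ)` with `η =
(δ/2)ε^α`, a bound whose factor does not see `δ` or the cut-off. If `α³(α-1)Λ⁴ > 2`, a cone power is
too convex to touch `v + η` from below, so `(v + η)^(1/α)` satisfies a one-sided Lipschitz bound
with constant `Λ` (`rpow_le_rpow_add_of_isViscositySuper`). In the limit, at a zero `x`, this reads
`u(y) ≤ (Λ|y - x|)^α`. Since `α > 1` and `u ≥ 0`, differentiability with zero gradient and the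
expansion along the free boundary follow.

Nondegeneracy. In `{u > 0}` the limit solves the singular equation by stability; a small `sup u`
would let a paraboloid that is too flat touch `u` from above
(`mul_rpow_alpha_le_of_isViscositySub`). -/

namespace SingularInfinity

/-! ### Calculus of the infinity Laplacian. -/

section InfinityLaplacian

variable {n : ℕ}

open scoped RealInnerProductSpace

lemma infLaplacian_eq_inner {ψ : Rn n → ℝ} {F : Rn n → Rn n} {F' : Rn n →L[ℝ] Rn n} {x : Rn n}
    (h : ∀ᶠ y in 𝓝 x, HasGradientAt ψ (F y) y) (hF : HasFDerivAt F F' x) :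
    infLaplacian ψ x = ⟪F' (F x), F x⟫ := by
  have h1 : fderiv ℝ ψ =ᶠ[𝓝 x] fun y => innerSL ℝ (F y) := by
    filter_upwards [h] with y hy
    rw [hy.hasFDerivAt.fderiv]
    ext v
    simp
  have h2 : HasFDerivAt (fderiv ℝ ψ) ((innerSL ℝ : Rn n →L[ℝ] Rn n →L[ℝ] ℝ).comp F') x :=
    ((innerSL ℝ : Rn n →L[ℝ] Rn n →L[ℝ] ℝ).hasFDerivAt.comp x hF).congr_of_eventuallyEq h1
  have h3 : gradient ψ x = F x := h.self_of_nhds.gradient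
  rw [infLaplacian, h2.fderiv, h3]
  rfl

lemma infLaplacian_neg (ψ : Rn n → ℝ) (x : Rn n) :
    infLaplacian (fun y => -ψ y) x = -infLaplacian ψ x := by
  have h1 : fderiv ℝ (fun y => -ψ y) = fun y => -fderiv ℝ ψ y := by
    funext y; exact fderiv_neg
  have h2 : gradient (fun y => -ψ y) x = -gradient ψ x := by
    simp [gradient]
  have h3 : fderiv ℝ (fun y => -fderiv ℝ ψ y) x = -fderiv ℝ (fderiv ℝ ψ) x := fderiv_neg
  rw [infLaplacian, h1, h2, h3]
  simp [infLaplacian]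

lemma hasFDerivAt_normSq_sub (p y : Rn n) :
    HasFDerivAt (fun x : Rn n => ‖x - p‖ ^ 2) (2 • innerSL ℝ (y - p)) y := by
  have := ((hasFDerivAt_id (𝕜 := ℝ) y).sub_const p).norm_sq
  simpa using this

lemma hasGradientAt_radial {g : ℝ → ℝ} {g' : ℝ} {p y : Rn n}
    (h : HasDerivAt g g' (‖y - p‖ ^ 2)) :
    HasGradientAt (fun x : Rn n => g (‖x - p‖ ^ 2)) ((2 * g') • (y - p)) y := by
  rw [hasGradientAt_iff_hasFDerivAt]
  have := h.comp_hasFDerivAt y (hasFDerivAt_normSq_sub p y)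
  refine this.congr_fderiv ?_
  ext v
  simp
  ring

/-- The infinity Laplacian of a radial function `x ↦ g (|x - p|²)`. -/
lemma infLaplacian_radial {g g₁ : ℝ → ℝ} {g₂ : ℝ} {p x : Rn n}
    (h1 : ∀ᶠ s in 𝓝 (‖x - p‖ ^ 2), HasDerivAt g (g₁ s) s)
    (h2 : HasDerivAt g₁ g₂ (‖x - p‖ ^ 2)) :
    infLaplacian (fun y => g (‖y - p‖ ^ 2)) x =
      8 * g₁ (‖x - p‖ ^ 2) ^ 2 * ‖x - p‖ ^ 2 *
        (g₁ (‖x - p‖ ^ 2) + 2 * ‖x - p‖ ^ 2 * g₂) := by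
  have hc : ContinuousAt (fun y : Rn n => ‖y - p‖ ^ 2) x := by fun_prop
  have hF : HasFDerivAt (fun y : Rn n => (2 * g₁ (‖y - p‖ ^ 2)) • (y - p)) _ x :=
    ((h2.comp_hasFDerivAt x (hasFDerivAt_normSq_sub p x)).const_mul 2).smul
      ((hasFDerivAt_id (𝕜 := ℝ) x).sub_const p)
  rw [infLaplacian_eq_inner ((hc.eventually h1).mono fun y hy => hasGradientAt_radial hy) hF]
  simp only [Function.comp_apply]
  generalize x - p = e
  simp [inner_add_left, inner_smul_left, inner_smul_right]
  ring

lemma infLaplacian_const_mul_normSq (A : ℝ) (p x : Rn n) :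
    infLaplacian (fun y => A * ‖y - p‖ ^ 2) x = 8 * A ^ 3 * ‖x - p‖ ^ 2 := by
  have := infLaplacian_radial (g := fun s => A * s) (g₁ := fun _ => A) (g₂ := 0) (p := p) (x := x)
    (Eventually.of_forall fun s => by simpa using (hasDerivAt_id s).const_mul A)
    (hasDerivAt_const _ _)
  rw [this]; ring

lemma contDiff_const_mul_normSq (A : ℝ) (p : Rn n) :
    ContDiff ℝ 2 (fun y : Rn n => A * ‖y - p‖ ^ 2) :=
  contDiff_const.mul ((contDiff_id.sub contDiff_const).norm_sq ℝ)

lemma ContDiffAt.continuousAt_infLaplacian {ψ : Rn n → ℝ} {x : Rn n} (h : ContDiffAt ℝ 2 ψ x) :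
    ContinuousAt (infLaplacian ψ) x := by
  have h1 : ContDiffAt ℝ 1 (fderiv ℝ ψ) x := h.fderiv_right (by norm_num)
  have h2 : ContinuousAt (fderiv ℝ (fderiv ℝ ψ)) x :=
    (h1.fderiv_right (m := 0) (by norm_num)).continuousAt
  have h3 : ContinuousAt (gradient ψ) x :=
    (LinearIsometryEquiv.continuous _).continuousAt.comp h1.continuousAt
  exact (h2.clm_apply h3).clm_apply h3

/-- The perturbation leaves the gradient at `x` unchanged and adds `2τ I` to the Hessian. It serves
to make a touching point strict. -/
lemma infLaplacian_add_normSq {ψ : Rn n → ℝ} {x : Rn n} (h : ContDiffAt ℝ 2 ψ x) (τ : ℝ) :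
    infLaplacian (fun y => ψ y + τ * ‖y - x‖ ^ 2) x =
      infLaplacian ψ x + 2 * τ * ‖gradient ψ x‖ ^ 2 := by
  have h1 : ContDiffAt ℝ 1 (fderiv ℝ ψ) x := h.fderiv_right (by norm_num)
  have h2 : ∀ᶠ y in 𝓝 x, HasGradientAt ψ (gradient ψ y) y := by
    filter_upwards [h.eventually (by simp)] with y hy
    exact (hy.differentiableAt (by norm_num)).hasGradientAt
  have h3 : DifferentiableAt ℝ (gradient ψ) x :=
    (LinearIsometryEquiv.differentiable _).differentiableAt.comp x
      (h1.differentiableAt (by norm_num))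
  have h4 := h3.hasFDerivAt
  have h5 : ∀ᶠ y in 𝓝 x, HasGradientAt (fun y => ψ y + τ * ‖y - x‖ ^ 2)
      (gradient ψ y + (2 * τ) • (y - x)) y := by
    filter_upwards [h2] with y hy
    have h6 := hasGradientAt_radial (g := fun s => τ * s) (g' := τ) (p := x) (y := y)
      (by simpa using (hasDerivAt_id (‖y - x‖ ^ 2)).const_mul τ)
    rw [hasGradientAt_iff_hasFDerivAt] at hy h6 ⊢
    refine (hy.add h6).congr_fderiv ?_
    rw [map_add]
  have h7 := h4.fun_add (((hasFDerivAt_id (𝕜 := ℝ) x).sub_const x).const_smul (2 * τ))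
  rw [infLaplacian_eq_inner h5 h7, infLaplacian_eq_inner h2 h4]
  generalize gradient ψ x = w
  generalize fderiv ℝ (gradient ψ) x = T
  simp [inner_add_left, inner_smul_left]

end InfinityLaplacian

/-! ### Stability of viscosity inequalities under locally uniform limits. -/

section Stability

variable {n : ℕ}

/-- Stability of viscosity subsolutions under locally uniform convergence. -/
lemma le_infLaplacian_of_tendstoLocallyUniformlyOn {Ω : Set (Rn n)} (hΩ : IsOpen Ω)
    {G : ℕ → ℝ → ℝ} {v : ℕ → Rn n → ℝ} {u : Rn n → ℝ} {g : ℝ} {x : Rn n} (hx : x ∈ Ω)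
    (hcont : ∀ k, ContinuousOn (v k) Ω) (hsub : ∀ k, IsViscositySub (G k) Ω (v k))
    (hlim : TendstoLocallyUniformlyOn v u atTop Ω)
    (hG : Tendsto (fun q : ℕ × ℝ => G q.1 q.2) (atTop ×ˢ 𝓝 (u x)) (𝓝 g))
    {ψ : Rn n → ℝ} (hψ : ContDiffAt ℝ 2 ψ x) (hmax : IsLocalMax (fun y => u y - ψ y) x) :
    g ≤ infLaplacian ψ x := by
  by_contra! hlt
  -- Adding `τ|y - x|²` makes the maximum at `x` strict while a small `τ` keeps the inequality to be
  -- contradicted.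
  obtain ⟨τ, hτ, hτlt⟩ : ∃ τ : ℝ, 0 < τ ∧ infLaplacian ψ x + 2 * τ * ‖gradient ψ x‖ ^ 2 < g := by
    have h : Tendsto (fun τ : ℝ => infLaplacian ψ x + 2 * τ * ‖gradient ψ x‖ ^ 2) (𝓝[>] 0)
        (𝓝 (infLaplacian ψ x + 2 * 0 * ‖gradient ψ x‖ ^ 2)) :=
      (Continuous.tendsto (by fun_prop) 0).mono_left nhdsWithin_le_nhds
    have h' := (h.eventually_lt_const (by simpa using hlt)).and self_mem_nhdsWithin
    obtain ⟨τ, h1, h2⟩ := h'.exists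
    exact ⟨τ, h2, h1⟩
  obtain ⟨g', hg1, hg2⟩ := exists_between hτlt
  set Ψ : Rn n → ℝ := fun y => ψ y + τ * ‖y - x‖ ^ 2 with hΨ
  have hΨC : ContDiffAt ℝ 2 Ψ x := hψ.add (contDiff_const_mul_normSq τ x).contDiffAt
  have hΨlt : infLaplacian Ψ x < g' := by rw [hΨ, infLaplacian_add_normSq hψ]; exact hg1
  have hu : ContinuousAt u x :=
    (hlim.continuousOn (Frequently.of_forall hcont)).continuousAt (hΩ.mem_nhds hx)
  obtain ⟨K, hK, S, hS, hKS⟩ := (eventually_prod_iff.1 (hG.eventually_const_lt hg2))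
  obtain ⟨ρ, hρ, hρS⟩ := Metric.eventually_nhds_iff.1 hS
  have hev : ∀ᶠ y in 𝓝 x, y ∈ Ω ∧ ContDiffAt ℝ 2 Ψ y ∧ infLaplacian Ψ y < g' ∧
      u y - ψ y ≤ u x - ψ x ∧ dist (u y) (u x) < ρ / 2 := by
    filter_upwards [hΩ.mem_nhds hx, hΨC.eventually (by simp),
      (ContDiffAt.continuousAt_infLaplacian hΨC).eventually_lt_const hΨlt, hmax,
      Metric.tendsto_nhds.1 hu (ρ / 2) (by positivity)] with y h1 h2 h3 h4 h5
    exact ⟨h1, h2, h3, h4, h5⟩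
  obtain ⟨r, hr, hrall⟩ := Metric.nhds_basis_closedBall.eventually_iff.1 hev
  have hball : Metric.closedBall x r ⊆ Ω := fun y hy => (hrall hy).1
  have hcomp : IsCompact (Metric.closedBall x r) := isCompact_closedBall x r
  have hunif : TendstoUniformlyOn v u atTop (Metric.closedBall x r) :=
    (tendstoLocallyUniformlyOn_iff_forall_isCompact hΩ).1 hlim _ hball hcomp
  -- On the sphere of radius `r` the perturbed difference for `u` lies at least `τr²` below its
  -- value at `x`. Two errors under `τr²/3` cannot close this gap, so the maximum for `v k` is
  -- interior. The bound `ρ/2` keeps `v k y` where the source exceeds `g'`.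
  obtain ⟨k, hk1, hk2⟩ := ((Metric.tendstoUniformlyOn_iff.1 hunif (min (ρ / 2) (τ * r ^ 2 / 3))
    (by positivity)).and hK).exists
  obtain ⟨y, hy, hymax⟩ := hcomp.exists_isMaxOn ⟨x, Metric.mem_closedBall_self hr.le⟩
    (f := fun y => v k y - Ψ y) (((hcont k).mono hball).sub
      fun y hy => (hrall hy).2.1.continuousAt.continuousWithinAt)
  obtain ⟨-, hy2, hy3, hy4, hy5⟩ := hrall hy
  have hclose := hk1 y hy
  have hclosex := hk1 x (Metric.mem_closedBall_self hr.le)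
  have hle := hymax (Metric.mem_closedBall_self hr.le)
  simp only [Set.mem_ofPred_eq, hΨ, sub_self, norm_zero] at hle
  rw [lt_min_iff, Real.dist_eq, abs_lt] at hclose hclosex
  have hyr : dist y x < r := by
    refine lt_of_le_of_ne hy fun heq => ?_
    rw [dist_eq_norm] at heq
    rw [heq] at hle
    have h1 := (abs_lt.1 hclose.2).1
    have h2 := (abs_lt.1 hclosex.2).2
    have : 0 < τ * r ^ 2 := by positivity
    linarith
  have hloc : IsLocalMax (fun y => v k y - Ψ y) y :=
    hymax.isLocalMax (Metric.closedBall_mem_nhds_of_mem hyr)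
  have h1 := hsub k y (hball hy) Ψ hy2 hloc
  have h2 : dist (v k y) (u x) < ρ := by
    calc dist (v k y) (u x) ≤ dist (u y) (v k y) + dist (u y) (u x) := dist_triangle_left _ _ _
      _ < ρ / 2 + ρ / 2 := by
        refine add_lt_add ?_ hy5
        rw [Real.dist_eq]; exact abs_lt.2 hclose.1
      _ = ρ := by ring
  have h3 := hKS hk2 (hρS h2)
  linarith

lemma IsViscositySuper.neg {G : ℝ → ℝ} {U : Set (Rn n)} {u : Rn n → ℝ}
    (h : IsViscositySuper G U u) :
    IsViscositySub (fun s => -G (-s)) U (fun y => -u y) := by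
  intro x hx ψ hψ hmax
  have h1 := h x hx (fun y => -ψ y) hψ.neg (by
    have := hmax.neg
    simpa [neg_sub, sub_eq_add_neg, add_comm] using this)
  rw [infLaplacian_neg] at h1
  simpa using (by linarith : -G (u x) ≤ infLaplacian ψ x)

lemma infLaplacian_le_of_tendstoLocallyUniformlyOn {Ω : Set (Rn n)} (hΩ : IsOpen Ω)
    {G : ℕ → ℝ → ℝ} {v : ℕ → Rn n → ℝ} {u : Rn n → ℝ} {g : ℝ} {x : Rn n} (hx : x ∈ Ω)
    (hcont : ∀ k, ContinuousOn (v k) Ω) (hsuper : ∀ k, IsViscositySuper (G k) Ω (v k))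
    (hlim : TendstoLocallyUniformlyOn v u atTop Ω)
    (hG : Tendsto (fun q : ℕ × ℝ => G q.1 q.2) (atTop ×ˢ 𝓝 (u x)) (𝓝 g))
    {ψ : Rn n → ℝ} (hψ : ContDiffAt ℝ 2 ψ x) (hmin : IsLocalMin (fun y => u y - ψ y) x) :
    infLaplacian ψ x ≤ g := by
  have h1 : TendstoLocallyUniformlyOn (fun k y => -v k y) (fun y => -u y) atTop Ω := by
    rw [Metric.tendstoLocallyUniformlyOn_iff] at hlim ⊢
    simpa only [dist_neg_neg] using hlim
  have h2 : Tendsto (fun q : ℕ × ℝ => -G q.1 (-q.2)) (atTop ×ˢ 𝓝 (-u x)) (𝓝 (-g)) := by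
    refine (hG.comp (tendsto_fst.prodMk (?_ : Tendsto (fun q : ℕ × ℝ => -q.2) _ _))).neg
    simpa using (tendsto_snd (f := (atTop : Filter ℕ)) (g := 𝓝 (-u x))).neg
  have h3 := le_infLaplacian_of_tendstoLocallyUniformlyOn hΩ (G := fun k s => -G k (-s)) hx
    (fun k => (hcont k).neg) (fun k => (hsuper k).neg) h1 h2 hψ.neg (by
      have := hmin.neg
      simpa [neg_sub, sub_eq_add_neg, add_comm] using this)
  rw [infLaplacian_neg] at h3
  linarith

end Stability

/-! ### Arithmetic of the exponent. -/

section Exponent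

variable {γ : ℝ}

lemma one_lt_alpha (hγ0 : 0 ≤ γ) (hγ1 : γ < 1) : 1 < alpha γ := by
  rw [alpha, lt_div_iff₀ (by linarith)]; linarith

lemma three_mul_alpha_sub_four (hγ0 : 0 ≤ γ) : 3 * alpha γ - 4 = -(alpha γ * γ) := by
  have : 3 + γ ≠ 0 := by linarith
  rw [alpha]; field_simp; ring

lemma one_add_div_eq_alpha (hγ0 : 0 ≤ γ) : 1 + (1 - γ) / (3 + γ) = alpha γ := by
  have : 3 + γ ≠ 0 := by linarith
  rw [alpha]; field_simp; ring

end Exponent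

/-! ### Powers of cones as barriers. -/

section Barrier

variable {n : ℕ}

lemma contDiffAt_cone_rpow {α Λ a : ℝ} {p y : Rn n} (hy : y ≠ p) (ha : 0 < a - Λ * ‖y - p‖) :
    ContDiffAt ℝ 2 (fun z : Rn n => (a - Λ * ‖z - p‖) ^ α) y := by
  have h1 : ContDiffAt ℝ 2 (fun z : Rn n => ‖z - p‖) y :=
    (contDiffAt_id.sub contDiffAt_const).norm ℝ (sub_ne_zero.2 hy)
  exact (contDiffAt_const.sub (contDiffAt_const.mul h1)).rpow_const_of_ne ha.ne'

/-- The infinity Laplacian of a power of a cone. -/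
lemma infLaplacian_cone_rpow {α Λ a : ℝ} {p y : Rn n} (hy : y ≠ p) (ha : 0 < a - Λ * ‖y - p‖) :
    infLaplacian (fun z : Rn n => (a - Λ * ‖z - p‖) ^ α) y =
      α ^ 3 * (α - 1) * Λ ^ 4 * (a - Λ * ‖y - p‖) ^ (3 * α - 4) := by
  have ht : 0 < ‖y - p‖ := norm_pos_iff.2 (sub_ne_zero.2 hy)
  have hsq : √(‖y - p‖ ^ 2) = ‖y - p‖ := Real.sqrt_sq ht.le
  have hs : 0 < ‖y - p‖ ^ 2 := by positivity
  have hb : 0 < a - Λ * √(‖y - p‖ ^ 2) := by rwa [hsq]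
  have hd : ∀ β s : ℝ, 0 < s → 0 < a - Λ * √s →
      HasDerivAt (fun s => (a - Λ * √s) ^ β)
        (-(Λ * (1 / (2 * √s))) * β * (a - Λ * √s) ^ (β - 1)) s := fun β s h0 h1 =>
    (((Real.hasDerivAt_sqrt h0.ne').const_mul Λ).const_sub a).rpow_const (Or.inl h1.ne')
  have h1 : ∀ᶠ s in 𝓝 (‖y - p‖ ^ 2), HasDerivAt (fun s => (a - Λ * √s) ^ α)
      (-(α * Λ / 2) * ((a - Λ * √s) ^ (α - 1) * (√s)⁻¹)) s := by
    have hc : ContinuousAt (fun s : ℝ => a - Λ * √s) (‖y - p‖ ^ 2) := by fun_prop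
    filter_upwards [lt_mem_nhds hs, hc.eventually_const_lt hb] with s h2 h3
    refine (hd α s h2 h3).congr_deriv ?_
    rw [one_div, mul_inv]; ring
  have h2 := (((hd (α - 1) _ hs hb).mul
    ((Real.hasDerivAt_sqrt hs.ne').inv (by rw [hsq]; exact ht.ne'))).const_mul (-(α * Λ / 2)))
  have key := infLaplacian_radial (p := p) (x := y) (g₁ := fun s =>
    -(α * Λ / 2) * ((a - Λ * √s) ^ (α - 1) * (√s)⁻¹)) h1 h2
  have hsqrt : ∀ z : Rn n, √(‖z - p‖ ^ 2) = ‖z - p‖ := fun z => Real.sqrt_sq (norm_nonneg _)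
  simp only [hsqrt] at key
  rw [key]
  set b := a - Λ * ‖y - p‖
  -- All powers of `b` are expressed through `b ^ (α - 2)`, so that only algebra remains.
  have e1 : b ^ (α - 1) = b ^ (α - 2) * b := by
    rw [← Real.rpow_add_one ha.ne']; ring_nf
  have e2 : b ^ (α - 1 - 1) = b ^ (α - 2) := by ring_nf
  have e3 : b ^ (3 * α - 4) = (b ^ (α - 2)) ^ 3 * b ^ 2 := by
    rw [← Real.rpow_natCast, ← Real.rpow_natCast, ← Real.rpow_mul ha.le, ← Real.rpow_add ha]
    push_cast; ring_nf
  simp only [Pi.inv_apply, hsqrt]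
  rw [e1, e2, e3]
  field_simp
  ring

end Barrier

/-! ### Minimum principle, nondegeneracy and the one-sided Lipschitz bound. -/

section Comparison

variable {n : ℕ}

/-- Minimum principle for infinity superharmonic functions on the set where they are negative. -/
lemma nonneg_of_isViscositySuper {Ω : Set (Rn n)} (hΩ : IsOpen Ω) (hb : Bornology.IsBounded Ω)
    (hne : Ω ≠ Set.univ) {G : ℝ → ℝ} (hG : ∀ s, s < 0 → G s ≤ 0) {v : Rn n → ℝ}
    (hv : ContinuousOn v (closure Ω)) (hsuper : IsViscositySuper G Ω v)
    (hbd : ∀ x ∈ frontier Ω, 0 ≤ v x) {x : Rn n} (hx : x ∈ Ω) : 0 ≤ v x := by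
  by_contra! hneg
  -- Centring the paraboloid outside `Ω` keeps its gradient nonzero in `Ω`, hence its infinity
  -- Laplacian strictly positive there.
  obtain ⟨z, hz⟩ := (Set.ne_univ_iff_exists_notMem Ω).1 hne
  have hcomp : IsCompact (closure Ω) := hb.isCompact_closure
  obtain ⟨R, hR⟩ := (hcomp.image (f := fun y : Rn n => ‖y - z‖ ^ 2) (by fun_prop)).bddAbove
  have hR' : ∀ y ∈ closure Ω, ‖y - z‖ ^ 2 ≤ R := fun y hy => hR (Set.mem_image_of_mem _ hy)
  have hR0 : 0 ≤ R := (sq_nonneg _).trans (hR' x (subset_closure hx))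
  obtain ⟨η, hη, hηR⟩ : ∃ η : ℝ, 0 < η ∧ η * R < -v x := by
    refine ⟨-v x / (R + 1), div_pos (by linarith) (by linarith), ?_⟩
    rw [div_mul_eq_mul_div, div_lt_iff₀ (by linarith)]
    nlinarith
  obtain ⟨y, hy, hmin⟩ := hcomp.exists_isMinOn ⟨x, subset_closure hx⟩
    (f := fun y => v y - η * ‖y - z‖ ^ 2) (hv.sub (by fun_prop))
  have hle : v y - η * ‖y - z‖ ^ 2 ≤ v x - η * ‖x - z‖ ^ 2 := hmin (subset_closure hx)
  have h1 : η * ‖y - z‖ ^ 2 ≤ η * R := mul_le_mul_of_nonneg_left (hR' y hy) hη.le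
  have h2 : 0 ≤ η * ‖x - z‖ ^ 2 := by positivity
  have hvy : v y < 0 := by linarith
  have hyΩ : y ∈ Ω := by
    by_contra hy'
    have := hbd y ⟨hy, by rwa [hΩ.interior_eq]⟩
    linarith
  have hloc : IsLocalMin (fun y => v y - η * ‖y - z‖ ^ 2) y :=
    hmin.isLocalMin (mem_of_superset (hΩ.mem_nhds hyΩ) subset_closure)
  have h3 := hsuper y hyΩ _ (contDiff_const_mul_normSq η z).contDiffAt hloc
  rw [infLaplacian_const_mul_normSq] at h3
  have hyz : 0 < ‖y - z‖ := norm_pos_iff.2 (sub_ne_zero.2 fun h => hz (h ▸ hyΩ))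
  have h4 : 0 < 8 * η ^ 3 * ‖y - z‖ ^ 2 := by positivity
  linarith [hG _ hvy]

/-- Nondegeneracy at free boundary points. -/
lemma mul_rpow_alpha_le_of_isViscositySub {γ : ℝ} (hγ0 : 0 ≤ γ) {Ω : Set (Rn n)} {u : Rn n → ℝ}
    (hu : ContinuousOn u Ω) (hsub : IsViscositySub (fun s => s ^ (-γ)) (posSet Ω u) u)
    {x : Rn n} (hx : x ∈ frontier (posSet Ω u)) {r S : ℝ} (hr : 0 < r)
    (hball : Metric.ball x r ⊆ Ω) (hS : ∀ y ∈ Metric.ball x r, u y ≤ S) :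
    (1 / 128) ^ (1 / (3 + γ)) * r ^ alpha γ ≤ S := by
  -- The paraboloid is centred at a nearby point where `u > 0`, so that the maximum below falls in
  -- `{u > 0}`, where the equation holds.
  obtain ⟨p, hp, hpx⟩ := Metric.mem_closure_iff.1 (frontier_subset_closure hx) (r / 2) (by positivity)
  set ρ := r / 2 with hρdef
  have hρ : 0 < ρ := by positivity
  have hsubset : Metric.closedBall p ρ ⊆ Metric.ball x r := fun y hy => by
    rw [Metric.mem_closedBall] at hy
    rw [Metric.mem_ball]
    have := dist_triangle y p x
    rw [dist_comm p x] at this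
    linarith
  have hpmem : p ∈ Metric.closedBall p ρ := Metric.mem_closedBall_self hρ.le
  have hS0 : 0 < S := hp.2.trans_le (hS p (hsubset hpmem))
  -- With this `A` the paraboloid equals `S ≥ u` on the sphere of radius `ρ`, while the difference
  -- at `p` is positive: the maximum is interior.
  set A := S / ρ ^ 2 with hA
  have hA0 : 0 < A := by positivity
  obtain ⟨y, hy, hmax⟩ := (isCompact_closedBall p ρ).exists_isMaxOn ⟨p, hpmem⟩
    (f := fun y => u y - A * ‖y - p‖ ^ 2)
    ((hu.mono (hsubset.trans hball)).sub (by fun_prop))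
  have hle : u p - A * ‖p - p‖ ^ 2 ≤ u y - A * ‖y - p‖ ^ 2 := hmax hpmem
  rw [sub_self, norm_zero] at hle
  have hup := hp.2
  have h1 : 0 ≤ A * ‖y - p‖ ^ 2 := by positivity
  have huy : 0 < u y := by linarith
  have hyS := hS y (hsubset hy)
  have hylt : dist y p < ρ := by
    refine lt_of_le_of_ne hy fun heq => ?_
    rw [dist_eq_norm] at heq
    have : A * ρ ^ 2 = S := by rw [hA]; field_simp
    rw [heq, this] at hle
    linarith
  have h2 := hsub y ⟨hball (hsubset hy), huy⟩ _ (contDiff_const_mul_normSq A p).contDiffAt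
    (hmax.isLocalMax (Metric.closedBall_mem_nhds_of_mem hylt))
  rw [infLaplacian_const_mul_normSq] at h2
  have h3 : S ^ (-γ) ≤ u y ^ (-γ) := Real.rpow_le_rpow_of_nonpos huy hyS (by linarith)
  have h4 : ‖y - p‖ ^ 2 ≤ ρ ^ 2 := by
    rw [← dist_eq_norm]; exact pow_le_pow_left₀ dist_nonneg hylt.le 2
  have h5 : S ^ (-γ) ≤ 8 * A ^ 3 * ρ ^ 2 :=
    h3.trans (h2.trans (mul_le_mul_of_nonneg_left h4 (by positivity)))
  have h6 : S ^ (-γ) * ρ ^ 4 ≤ 8 * S ^ 3 := by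
    calc S ^ (-γ) * ρ ^ 4 ≤ 8 * A ^ 3 * ρ ^ 2 * ρ ^ 4 := by gcongr
      _ = 8 * S ^ 3 := by rw [hA]; field_simp
  have h7 : S ^ (3 + γ) * S ^ (-γ) = S ^ 3 := by
    rw [← Real.rpow_add hS0, ← Real.rpow_natCast]; push_cast; ring_nf
  -- Here `128 = 8 · 2⁴`: the `8` comes from the paraboloid and `2⁴` from `ρ = r / 2`.
  have h8 : 1 / 128 * r ^ 4 ≤ S ^ (3 + γ) := by
    have hpos : 0 < S ^ (-γ) := by positivity
    refine le_of_mul_le_mul_right ?_ hpos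
    rw [h7]
    rw [hρdef] at h6
    linear_combination h6 / 8
  have h9 : (1 / 128 * r ^ 4) ^ (1 / (3 + γ)) ≤ (S ^ (3 + γ)) ^ (1 / (3 + γ)) :=
    Real.rpow_le_rpow (by positivity) h8 (by positivity)
  rw [Real.mul_rpow (by norm_num) (by positivity), ← Real.rpow_mul hS0.le,
    mul_one_div_cancel (by linarith), Real.rpow_one, ← Real.rpow_natCast r 4,
    ← Real.rpow_mul hr.le] at h9
  convert h9 using 3
  rw [alpha]; push_cast; ring

/-- Lipschitz bound from below for the `1 / α` power of a nonnegative viscosity supersolution. -/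
lemma rpow_le_rpow_add_of_isViscositySuper {γ : ℝ} (hγ0 : 0 ≤ γ) (hγ1 : γ < 1) {Ω : Set (Rn n)}
    {G : ℝ → ℝ} {v : Rn n → ℝ} {η : ℝ} (hη : 0 < η) (hv : ContinuousOn v Ω)
    (hnonneg : ∀ x ∈ Ω, 0 ≤ v x) (hsuper : IsViscositySuper G Ω v)
    (hG : ∀ s, 0 ≤ s → G s ≤ 2 * (s + η) ^ (-γ)) {p : Rn n} {ρ Λ : ℝ}
    (hball : Metric.closedBall p ρ ⊆ Ω)
    (hΛ : 2 < alpha γ ^ 3 * (alpha γ - 1) * Λ ^ 4)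
    (hp : (v p + η) ^ (1 / alpha γ) ≤ Λ * ρ) {x : Rn n} (hx : x ∈ Metric.closedBall p ρ) :
    (v p + η) ^ (1 / alpha γ) ≤ (v x + η) ^ (1 / alpha γ) + Λ * ‖x - p‖ := by
  have hα := one_lt_alpha hγ0 hγ1
  set α := alpha γ with hαdef
  by_contra! hlt
  set w : Rn n → ℝ := fun y => (v y + η) ^ (1 / α) with hw
  have hwpos : ∀ y ∈ Ω, 0 < w y := fun y hy =>
    Real.rpow_pos_of_pos (by linarith [hnonneg y hy]) _
  have hwpow : ∀ y ∈ Ω, w y ^ α = v y + η := fun y hy => by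
    rw [hw, ← Real.rpow_mul (by linarith [hnonneg y hy]), one_div_mul_cancel (by linarith),
      Real.rpow_one]
  have hwc : ContinuousOn w (Metric.closedBall p ρ) :=
    ((hv.mono hball).add continuousOn_const).rpow_const fun _ _ => Or.inr (by positivity)
  obtain ⟨y, hy, hmin⟩ := (isCompact_closedBall p ρ).exists_isMinOn ⟨x, hx⟩
    (f := fun y => w y + Λ * ‖y - p‖) (hwc.add (by fun_prop))
  have hmin' : ∀ z ∈ Metric.closedBall p ρ, w y + Λ * ‖y - p‖ ≤ w z + Λ * ‖z - p‖ :=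
    fun z hz => hmin hz
  have hyp : w y + Λ * ‖y - p‖ < w p := (hmin' x hx).trans_lt hlt
  have hne : y ≠ p := by rintro rfl; simp at hyp
  have hwy := hwpos y (hball hy)
  -- On the sphere the cone term alone is `Λρ`, already at least `w p`; this is what `hp` is for.
  have hylt : dist y p < ρ := by
    refine lt_of_le_of_ne hy fun heq => ?_
    rw [dist_eq_norm] at heq
    rw [heq] at hyp
    linarith [show w p ≤ Λ * ρ from hp]
  set a := w y + Λ * ‖y - p‖ with ha
  have hay : a - Λ * ‖y - p‖ = w y := by rw [ha]; ring
  have hapos : 0 < a - Λ * ‖y - p‖ := by rwa [hay]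
  -- Minimality says that the cone of height `a` touches `w` from below at `y`; raising to the power
  -- `α` preserves this, and the constant `η` does not affect touching.
  have hloc : IsLocalMin (fun z => v z - (a - Λ * ‖z - p‖) ^ α) y := by
    have hc : ContinuousAt (fun z : Rn n => a - Λ * ‖z - p‖) y := by fun_prop
    filter_upwards [Metric.closedBall_mem_nhds_of_mem hylt, hc.eventually_const_lt hapos]
      with z hz hz0
    have h1 : (a - Λ * ‖z - p‖) ^ α ≤ w z ^ α :=
      Real.rpow_le_rpow hz0.le (by linarith [hmin' z hz]) (by linarith)
    rw [hwpow z (hball hz)] at h1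
    rw [hay, hwpow y (hball hy)]
    linarith
  have h1 := hsuper y (hball hy) _ (contDiffAt_cone_rpow hne hapos) hloc
  have hvy := hnonneg y (hball hy)
  rw [infLaplacian_cone_rpow hne hapos, hay, hαdef, three_mul_alpha_sub_four hγ0, ← hαdef,
    neg_mul_eq_mul_neg, Real.rpow_mul hwy.le, hwpow y (hball hy)] at h1
  have h2 : 0 < (v y + η) ^ (-γ) := Real.rpow_pos_of_pos (by linarith) _
  nlinarith [hG _ hvy]

end Comparison

/-! ### Bounds and limit of the penalized source. -/

section Source

variable {γ δ ε : ℝ} {B : ℝ → ℝ}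

lemma source_eq_zero (hB : IsCutoff δ B) (hε : 0 < ε) {s : ℝ} (hs : s ≤ δ / 2 * ε ^ alpha γ) :
    source γ B ε s = 0 := by
  rw [source, hB.eq_zero _ ((div_le_iff₀ (by positivity)).2 hs), zero_mul]

lemma source_eq_rpow (hB : IsCutoff δ B) (hε : 0 < ε) {s : ℝ} (hs : δ * ε ^ alpha γ ≤ s) :
    source γ B ε s = s ^ (-γ) := by
  rw [source, hB.eq_one _ ((le_div_iff₀ (by positivity)).2 hs), one_mul]

/-- The source vanishes up to `η`, and beyond it `s ≥ (s + η)/2` costs only a factor `2^γ ≤ 2`. -/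
lemma source_le (hγ0 : 0 ≤ γ) (hγ1 : γ < 1) (hδ : 0 < δ) (hB : IsCutoff δ B) (hε : 0 < ε) {s : ℝ}
    (hs : 0 ≤ s) :
    source γ B ε s ≤ 2 * (s + δ / 2 * ε ^ alpha γ) ^ (-γ) := by
  set η := δ / 2 * ε ^ alpha γ with hη
  have hη0 : 0 < η := by positivity
  rcases le_or_gt s η with h | h
  · rw [source_eq_zero hB hε h]; positivity
  · have hs0 : 0 < s := hη0.trans h
    have h0 : 0 ≤ s / ε ^ alpha γ := by positivity
    calc source γ B ε s ≤ 1 * s ^ (-γ) :=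
          mul_le_mul_of_nonneg_right (hB.le_one _ h0) (by positivity)
      _ ≤ ((s + η) / 2) ^ (-γ) := by
          rw [one_mul]
          exact Real.rpow_le_rpow_of_nonpos (by positivity) (by linarith) (by linarith)
      _ = 2 ^ γ * (s + η) ^ (-γ) := by
          rw [Real.div_rpow (by positivity) (by norm_num), Real.rpow_neg (by norm_num : (0:ℝ) ≤ 2),
            div_inv_eq_mul, mul_comm]
      _ ≤ 2 * (s + η) ^ (-γ) := by
          refine mul_le_mul_of_nonneg_right ?_ (by positivity)
          calc (2 : ℝ) ^ γ ≤ 2 ^ (1 : ℝ) := Real.rpow_le_rpow_of_exponent_le (by norm_num) hγ1.le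
            _ = 2 := Real.rpow_one 2

lemma tendsto_rpow_alpha_zero (hγ0 : 0 ≤ γ) (hγ1 : γ < 1) {ε : ℕ → ℝ}
    (hε : Tendsto ε atTop (𝓝 0)) (c : ℝ) :
    Tendsto (fun k => c * ε k ^ alpha γ) atTop (𝓝 0) := by
  have hα : 0 < alpha γ := by linarith [one_lt_alpha hγ0 hγ1]
  have := (hε.rpow_const (p := alpha γ) (Or.inr hα.le)).const_mul c
  rwa [Real.zero_rpow hα.ne', mul_zero] at this

/-- Near a positive value the cut-off is eventually identically `1`. The limit is joint because
stability evaluates the source at moving values. -/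
lemma tendsto_source (hγ0 : 0 ≤ γ) (hγ1 : γ < 1) (hB : IsCutoff δ B) {ε : ℕ → ℝ}
    (hε0 : ∀ k, 0 < ε k) (hε : Tendsto ε atTop (𝓝 0)) {s : ℝ} (hs : 0 < s) :
    Tendsto (fun q : ℕ × ℝ => source γ B (ε q.1) q.2) (atTop ×ˢ 𝓝 s) (𝓝 (s ^ (-γ))) := by
  have h1 : Tendsto (fun q : ℕ × ℝ => q.2 ^ (-γ)) (atTop ×ˢ 𝓝 s) (𝓝 (s ^ (-γ))) :=
    (Real.continuousAt_rpow_const s (-γ) (Or.inl hs.ne')).tendsto.comp tendsto_snd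
  refine h1.congr' ?_
  have h2 := ((tendsto_rpow_alpha_zero hγ0 hγ1 hε δ).eventually_lt_const (half_pos hs)).prod_mk
    (lt_mem_nhds (half_lt_self hs))
  filter_upwards [h2] with q hq
  exact (source_eq_rpow hB (hε0 _) (hq.1.trans hq.2).le).symm

end Source

/-! ### Properties of the limit function. -/

section Limit

variable {n : ℕ} {γ δ : ℝ} {B : ℝ → ℝ} {Ω : Set (Rn n)} {u : Rn n → ℝ}

lemma IsLimitOfMinimalSols.continuousOn (hlim : IsLimitOfMinimalSols γ B Ω u) :
    ContinuousOn u Ω := by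
  obtain ⟨ε, φ, v, -, -, -, hv, hvu⟩ := hlim
  exact hvu.continuousOn (Frequently.of_forall fun k => (hv k).1.cont)

lemma isOpen_posSet (hΩ : IsOpen Ω) (hu : ContinuousOn u Ω) : IsOpen (posSet Ω u) :=
  hu.isOpen_inter_preimage hΩ isOpen_Ioi

lemma IsLimitOfMinimalSols.isViscositySol (hγ0 : 0 ≤ γ) (hγ1 : γ < 1) (hΩ : IsOpen Ω)
    (hB : IsCutoff δ B) (hlim : IsLimitOfMinimalSols γ B Ω u) :
    IsViscositySol (fun s => s ^ (-γ)) (posSet Ω u) u := by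
  have hu := hlim.continuousOn
  obtain ⟨ε, φ, v, hε0, hε, -, hv, hvu⟩ := hlim
  refine ⟨hu.mono fun x hx => hx.1, fun x hx ψ hψ hmax => ?_, fun x hx ψ hψ hmin => ?_⟩
  · exact le_infLaplacian_of_tendstoLocallyUniformlyOn hΩ hx.1 (fun k => (hv k).1.cont)
      (fun k => (hv k).1.sub) hvu (tendsto_source hγ0 hγ1 hB hε0 hε hx.2) hψ hmax
  · exact infLaplacian_le_of_tendstoLocallyUniformlyOn hΩ hx.1 (fun k => (hv k).1.cont)
      (fun k => (hv k).1.super) hvu (tendsto_source hγ0 hγ1 hB hε0 hε hx.2) hψ hmin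

lemma IsMinimalSol.nonneg {ε : ℝ} {φ v : Rn n → ℝ} (hΩ : IsOpen Ω) (hb : Bornology.IsBounded Ω)
    (hne : Ω ≠ Set.univ) (hδ : 0 < δ) (hB : IsCutoff δ B) (hε : 0 < ε)
    (hφ : ∀ x ∈ frontier Ω, 0 ≤ φ x) (hv : IsMinimalSol γ B ε Ω φ v) {x : Rn n} (hx : x ∈ Ω) :
    0 ≤ v x := by
  obtain ⟨-, K, lo, hi, -, -, -, -, -, hbd, ⟨hvc, hsuper, hlohi⟩, -⟩ := hv
  refine nonneg_of_isViscositySuper hΩ hb hne (fun s hs => ?_) hvc hsuper (fun y hy => ?_) hx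
  · exact (source_eq_zero hB hε (hs.le.trans (by positivity))).le
  · exact ((hφ y hy).trans_eq (hbd y hy).1.symm).trans (hlohi y (frontier_subset_closure hy)).1

lemma IsLimitOfMinimalSols.nonneg (hΩ : IsOpen Ω) (hb : Bornology.IsBounded Ω)
    (hne : Ω ≠ Set.univ) (hδ : 0 < δ) (hB : IsCutoff δ B)
    (hlim : IsLimitOfMinimalSols γ B Ω u) {x : Rn n} (hx : x ∈ Ω) : 0 ≤ u x := by
  obtain ⟨ε, φ, v, hε0, hε, hφ, hv, hvu⟩ := hlim
  exact ge_of_tendsto' (hvu.tendsto_at hx) fun k =>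
    (hv k).nonneg hΩ hb hne hδ hB (hε0 k) (hφ k) hx

/-- Optimal growth away from a zero. -/
lemma IsLimitOfMinimalSols.le_rpow_alpha (hγ0 : 0 ≤ γ) (hγ1 : γ < 1) (hΩ : IsOpen Ω)
    (hb : Bornology.IsBounded Ω) (hne : Ω ≠ Set.univ) (hδ : 0 < δ) (hB : IsCutoff δ B)
    (hlim : IsLimitOfMinimalSols γ B Ω u) {M d Λ : ℝ} (hM : ∀ x ∈ Ω, |u x| ≤ M)
    (hΛ : 2 < alpha γ ^ 3 * (alpha γ - 1) * Λ ^ 4) (hΛM : |M| + 2 ≤ Λ * (d / 2))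
    {x : Rn n} (hball : Metric.ball x d ⊆ Ω) (hx : u x = 0) {y : Rn n}
    (hy : y ∈ Metric.ball x (d / 2)) : u y ≤ (Λ * ‖y - x‖) ^ alpha γ := by
  have hu0 : ∀ z ∈ Ω, 0 ≤ u z := fun z hz => hlim.nonneg hΩ hb hne hδ hB hz
  have hα := one_lt_alpha hγ0 hγ1
  have hyx : dist y x < d / 2 := hy
  have hd : 0 < d := by linarith [dist_nonneg (x := y) (y := x)]
  have hxΩ : x ∈ Ω := hball (Metric.mem_ball_self hd)
  -- The cone has its vertex at `y`, not at the zero `x`; hence the estimate is restricted to half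
  -- the radius.
  have hcb : Metric.closedBall y (d / 2) ⊆ Ω := fun z hz => hball <| by
    rw [Metric.mem_closedBall] at hz
    rw [Metric.mem_ball]
    linarith [dist_triangle z y x]
  have hyΩ : y ∈ Ω := hcb (Metric.mem_closedBall_self (by positivity))
  obtain ⟨ε, φ, v, hε0, hε, hφ, hv, hvu⟩ := hlim
  have hη := tendsto_rpow_alpha_zero hγ0 hγ1 hε (δ / 2)
  have hlimw : ∀ z ∈ Ω, Tendsto (fun k => (v k z + δ / 2 * ε k ^ alpha γ) ^ (1 / alpha γ)) atTop
      (𝓝 (u z ^ (1 / alpha γ))) := fun z hz => by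
    have := ((hvu.tendsto_at hz).add hη).rpow_const (p := 1 / alpha γ) (Or.inr (by positivity))
    rwa [add_zero] at this
  have huy : u y < |M| + 1 := by linarith [le_abs_self (u y), hM y hyΩ, le_abs_self M]
  have hev : ∀ᶠ k in atTop, (v k y + δ / 2 * ε k ^ alpha γ) ^ (1 / alpha γ) ≤
      (v k x + δ / 2 * ε k ^ alpha γ) ^ (1 / alpha γ) + Λ * ‖x - y‖ := by
    filter_upwards [(hvu.tendsto_at hyΩ).eventually_lt_const huy,
      hη.eventually_lt_const one_pos] with k hk1 hk2
    have hεk := hε0 k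
    have hnonneg : ∀ z ∈ Ω, 0 ≤ v k z := fun z hz =>
      (hv k).nonneg hΩ hb hne hδ hB (hε0 k) (hφ k) hz
    refine rpow_le_rpow_add_of_isViscositySuper (ρ := d / 2) hγ0 hγ1 (by positivity)
      (hv k).1.cont hnonneg (hv k).1.super
      (fun s hs => source_le hγ0 hγ1 hδ hB hεk hs) hcb hΛ ?_ ?_
    · have h1 : 0 ≤ v k y + δ / 2 * ε k ^ alpha γ := by
        have := hnonneg y hyΩ
        positivity
      calc (v k y + δ / 2 * ε k ^ alpha γ) ^ (1 / alpha γ)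
          ≤ (|M| + 2) ^ (1 / alpha γ) := Real.rpow_le_rpow h1 (by linarith) (by positivity)
        _ ≤ (|M| + 2) ^ (1 : ℝ) :=
            Real.rpow_le_rpow_of_exponent_le (by linarith [abs_nonneg M])
              ((div_le_one (by linarith)).2 hα.le)
        _ ≤ Λ * (d / 2) := by rwa [Real.rpow_one]
    · rw [Metric.mem_closedBall, dist_comm]; exact hyx.le
  have h1 := le_of_tendsto_of_tendsto (hlimw y hyΩ) ((hlimw x hxΩ).add_const _) hev
  rw [hx, Real.zero_rpow (by positivity), zero_add, norm_sub_rev] at h1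
  calc u y = (u y ^ (1 / alpha γ)) ^ alpha γ := by
        rw [← Real.rpow_mul (hu0 y hyΩ), one_div_mul_cancel (by linarith), Real.rpow_one]
    _ ≤ (Λ * ‖y - x‖) ^ alpha γ :=
        Real.rpow_le_rpow (Real.rpow_nonneg (hu0 y hyΩ) _) h1 (by linarith)

/-- The first bound beats the factor in `source_le`. The second covers `(v + η)^(1/α)`, since
eventually `v + η ≤ |M| + 2` at the vertex and `1/α ≤ 1`. -/
lemma exists_slope (hγ0 : 0 ≤ γ) (hγ1 : γ < 1) (M : ℝ) {d : ℝ} (hd : 0 < d) :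
    ∃ Λ : ℝ, 0 < Λ ∧ 2 < alpha γ ^ 3 * (alpha γ - 1) * Λ ^ 4 ∧ |M| + 2 ≤ Λ * (d / 2) := by
  have hα := one_lt_alpha hγ0 hγ1
  have hc : 0 < alpha γ ^ 3 * (alpha γ - 1) := mul_pos (by positivity) (by linarith)
  have hlarge : ∀ᶠ Λ : ℝ in atTop, 0 < Λ ∧ 2 < alpha γ ^ 3 * (alpha γ - 1) * Λ ^ 4 ∧
      |M| + 2 ≤ Λ * (d / 2) :=
    (eventually_gt_atTop 0).and
      ((((tendsto_pow_atTop (by norm_num)).const_mul_atTop hc).eventually_gt_atTop 2).and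
        ((tendsto_id.atTop_mul_const (half_pos hd)).eventually_ge_atTop _))
  exact hlarge.exists

lemma exists_ne_of_mem_frontier_posSet (hΩ : IsOpen Ω) (hu : ContinuousOn u Ω) {x : Rn n}
    (hx : x ∈ frontier (posSet Ω u)) : ∃ y, y ≠ x := by
  obtain ⟨h1, h2⟩ := hx
  rw [(isOpen_posSet hΩ hu).interior_eq] at h2
  obtain ⟨y, hy⟩ := closure_nonempty_iff.1 ⟨x, h1⟩
  exact ⟨y, fun h => h2 (h ▸ hy)⟩

/-- Only in dimension zero can a bounded set be the whole space, and a free boundary point rules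
this out by supplying two distinct points. -/
lemma ne_univ_of_mem_frontier_posSet (hΩ : IsOpen Ω) (hb : Bornology.IsBounded Ω)
    (hu : ContinuousOn u Ω) {x : Rn n} (hx : x ∈ frontier (posSet Ω u)) : Ω ≠ Set.univ := by
  obtain ⟨y, hy⟩ := exists_ne_of_mem_frontier_posSet hΩ hu hx
  have : Nontrivial (Rn n) := ⟨y, x, hy⟩
  rintro rfl
  exact NormedSpace.unbounded_univ ℝ (Rn n) hb

lemma eq_zero_of_mem_frontier_posSet (hΩ : IsOpen Ω) (hu : ContinuousOn u Ω)
    (hu0 : ∀ x ∈ Ω, 0 ≤ u x) {x : Rn n} (hx : x ∈ frontier (posSet Ω u)) (hxΩ : x ∈ Ω) :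
    u x = 0 := by
  have h2 := hx.2
  rw [(isOpen_posSet hΩ hu).interior_eq] at h2
  exact le_antisymm (not_lt.1 fun h => h2 ⟨hxΩ, h⟩) (hu0 x hxΩ)

end Limit

/-! ### Two general facts: superlinear decay and balls away from the boundary. -/

lemma hasFDerivAt_zero_of_abs_le_rpow {E : Type*} [NormedAddCommGroup E] [NormedSpace ℝ E]
    {f : E → ℝ} {x : E} {C α : ℝ} (hα : 1 < α)
    (h : ∀ᶠ y in 𝓝 x, |f y - f x| ≤ C * ‖y - x‖ ^ α) : HasFDerivAt f (0 : E →L[ℝ] ℝ) x := by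
  rw [hasFDerivAt_iff_isLittleO, Asymptotics.isLittleO_iff]
  intro c hc
  have h1 : Tendsto (fun y : E => C * ‖y - x‖ ^ (α - 1)) (𝓝 x) (𝓝 0) := by
    have hn : Tendsto (fun y : E => ‖y - x‖) (𝓝 x) (𝓝 0) := by
      have : ContinuousAt (fun y : E => ‖y - x‖) x := by fun_prop
      simpa [ContinuousAt] using this
    have := (hn.rpow_const (p := α - 1) (Or.inr (by linarith))).const_mul C
    rwa [Real.zero_rpow (by linarith), mul_zero] at this
  filter_upwards [h, h1.eventually_lt_const hc] with y hy hyc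
  have h2 : ‖y - x‖ ^ α = ‖y - x‖ ^ (α - 1) * ‖y - x‖ := by
    rw [← Real.rpow_add_one' (norm_nonneg _) (by linarith), sub_add_cancel]
  simp only [zero_apply, sub_zero, Real.norm_eq_abs]
  rw [h2, ← mul_assoc] at hy
  exact hy.trans (mul_le_mul_of_nonneg_right hyc.le (norm_nonneg _))

/-- The ball is connected, meets `Ω` and misses its frontier, so it cannot leave `Ω`. -/
lemma ball_subset_of_le_dist_frontier {E : Type*} [NormedAddCommGroup E] [NormedSpace ℝ E]
    {Ω : Set E} (hΩ : IsOpen Ω) {x : E} (hx : x ∈ Ω) {d : ℝ}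
    (h : ∀ z ∈ frontier Ω, d ≤ dist x z) : Metric.ball x d ⊆ Ω := by
  intro y hy
  have hd : 0 < d := Metric.nonempty_ball.1 ⟨y, hy⟩
  refine (convex_ball x d).isPreconnected.subset_of_closure_inter_subset hΩ
    ⟨x, Metric.mem_ball_self hd, hx⟩ (fun z hz => ?_) hy
  by_contra hzΩ
  have := h z ⟨hz.1, by rwa [hΩ.interior_eq]⟩
  have h2 : dist z x < d := hz.2
  rw [dist_comm] at h2
  linarith

end SingularInfinity

/-! ### The main theorem. -/

theorem theorem5p3 (n : ℕ) (γ : ℝ) (hγ0 : 0 ≤ γ) (hγ1 : γ < 1) (M d : ℝ) (hd : 0 < d) :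
    ∃ C c r₀ : ℝ, 0 < C ∧ 0 < c ∧ 0 < r₀ ∧ r₀ ≤ d ∧
      ∀ (Ω Ω' : Set (SingularInfinity.Rn n)) (δ : ℝ) (B : ℝ → ℝ) (u : SingularInfinity.Rn n → ℝ),
        IsOpen Ω → Bornology.IsBounded Ω →
        Ω' ⊆ Ω → (∀ x ∈ Ω', ∀ z ∈ frontier Ω, d ≤ dist x z) →
        0 < δ → SingularInfinity.IsCutoff δ B →
        SingularInfinity.IsLimitOfMinimalSols γ B Ω u →
        (∀ x ∈ Ω, |u x| ≤ M) →
        -- `u` solves the limiting equation in `{u > 0}`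
        SingularInfinity.IsViscositySol (fun s => s ^ (-γ)) (SingularInfinity.posSet Ω u) u ∧
        -- optimal growth and nondegeneracy at free boundary points
        (∀ x ∈ frontier (SingularInfinity.posSet Ω u) ∩ Ω', ∀ r : ℝ, 0 < r → r ≤ r₀ →
          c * r ^ SingularInfinity.alpha γ ≤ sSup (u '' Metric.ball x r) ∧
          sSup (u '' Metric.ball x r) ≤ C * r ^ SingularInfinity.alpha γ) ∧
        -- `u` is differentiable with `Du = 0` on the free boundary
        (∀ x ∈ frontier (SingularInfinity.posSet Ω u) ∩ Ω,
          HasFDerivAt u (0 : SingularInfinity.Rn n →L[ℝ] ℝ) x) ∧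
        -- `u` is `C^{1,(1-γ)/(3+γ)}` along the free boundary
        (∀ x ∈ frontier (SingularInfinity.posSet Ω u) ∩ Ω', ∀ y ∈ Metric.ball x r₀,
          |u y - u x - fderiv ℝ u x (y - x)| ≤ C * ‖y - x‖ ^ (1 + (1 - γ) / (3 + γ))) := by
  have hα := SingularInfinity.one_lt_alpha hγ0 hγ1
  obtain ⟨Λ, hΛ0, hΛ, hΛM⟩ := SingularInfinity.exists_slope hγ0 hγ1 M hd
  refine ⟨Λ ^ SingularInfinity.alpha γ, (1 / 128) ^ (1 / (3 + γ)), d / 2, by positivity, by positivity,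
    by positivity, by linarith, ?_⟩
  intro Ω Ω' δ B u hΩ hb hΩ' hdist hδ hB hlim hM
  have hu := hlim.continuousOn
  have hsol := hlim.isViscositySol hγ0 hγ1 hΩ hB
  have hnonneg : ∀ x ∈ frontier (SingularInfinity.posSet Ω u), ∀ y ∈ Ω, 0 ≤ u y := fun x hx y hy =>
    hlim.nonneg hΩ hb (SingularInfinity.ne_univ_of_mem_frontier_posSet hΩ hb hu hx) hδ hB hy
  have hzero : ∀ x ∈ frontier (SingularInfinity.posSet Ω u), x ∈ Ω → u x = 0 := fun x hx hxΩ =>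
    SingularInfinity.eq_zero_of_mem_frontier_posSet hΩ hu (hnonneg x hx) hx hxΩ
  have hball : ∀ x ∈ Ω', Metric.ball x d ⊆ Ω := fun x hx =>
    SingularInfinity.ball_subset_of_le_dist_frontier hΩ (hΩ' hx) (hdist x hx)
  have hgrowth : ∀ x ∈ frontier (SingularInfinity.posSet Ω u) ∩ Ω', ∀ y ∈ Metric.ball x (d / 2),
      u y ≤ Λ ^ SingularInfinity.alpha γ * ‖y - x‖ ^ SingularInfinity.alpha γ := fun x hx y hy => by
    rw [← Real.mul_rpow hΛ0.le (norm_nonneg _)]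
    exact hlim.le_rpow_alpha hγ0 hγ1 hΩ hb (SingularInfinity.ne_univ_of_mem_frontier_posSet hΩ hb hu hx.1) hδ hB
      hM hΛ hΛM (hball x hx.2) (hzero x hx.1 (hΩ' hx.2)) hy
  have hderiv : ∀ x ∈ frontier (SingularInfinity.posSet Ω u) ∩ Ω, HasFDerivAt u (0 : SingularInfinity.Rn n →L[ℝ] ℝ) x := by
    rintro x ⟨hx, hxΩ⟩
    obtain ⟨e, he, hxe⟩ := Metric.isOpen_iff.1 hΩ x hxΩ
    -- Differentiability is claimed in all of `Ω`, so the slope is adapted to a ball around this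
    -- point; no uniformity is needed.
    obtain ⟨L, hL0, hL, hLM⟩ := SingularInfinity.exists_slope hγ0 hγ1 M he
    refine SingularInfinity.hasFDerivAt_zero_of_abs_le_rpow (C := L ^ SingularInfinity.alpha γ) hα ?_
    filter_upwards [Metric.ball_mem_nhds x (half_pos he)] with y hy
    have hyΩ : y ∈ Ω := hxe (Metric.ball_subset_ball (by linarith) hy)
    rw [hzero x hx hxΩ, sub_zero, abs_of_nonneg (hnonneg x hx y hyΩ),
      ← Real.mul_rpow hL0.le (norm_nonneg _)]
    exact hlim.le_rpow_alpha hγ0 hγ1 hΩ hb (SingularInfinity.ne_univ_of_mem_frontier_posSet hΩ hb hu hx) hδ hB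
      hM hL hLM hxe (hzero x hx hxΩ) hy
  refine ⟨hsol, fun x hx r hr hrd => ⟨?_, ?_⟩, hderiv, fun x hx y hy => ?_⟩
  · have hsub : Metric.ball x r ⊆ Ω :=
      (Metric.ball_subset_ball (by linarith)).trans (hball x hx.2)
    refine SingularInfinity.mul_rpow_alpha_le_of_isViscositySub hγ0 hu hsol.sub hx.1 hr hsub fun y hy => ?_
    refine le_csSup ⟨M, ?_⟩ (Set.mem_image_of_mem u hy)
    rintro _ ⟨z, hz, rfl⟩
    exact (le_abs_self _).trans (hM z (hsub hz))
  · refine csSup_le ((Metric.nonempty_ball.2 hr).image u) ?_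
    rintro _ ⟨y, hy, rfl⟩
    refine (hgrowth x hx y (Metric.ball_subset_ball hrd hy)).trans ?_
    have : ‖y - x‖ ≤ r := by rw [← dist_eq_norm]; exact (Metric.mem_ball.1 hy).le
    gcongr
  · have hyΩ : y ∈ Ω := hball x hx.2 (Metric.ball_subset_ball (by linarith) hy)
    rw [(hderiv x ⟨hx.1, hΩ' hx.2⟩).fderiv, hzero x hx.1 (hΩ' hx.2),
      zero_apply, sub_zero, sub_zero, abs_of_nonneg (hnonneg x hx.1 y hyΩ),
      SingularInfinity.one_add_div_eq_alpha hγ0]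
    exact hgrowth x hx y hy
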